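/- Let $V=\{1,\dots,n\}$ be partitioned into $k$ nonempty clusters, where $3\le k<n$. The partition $C$ is unknown. Let $f_g,f_r$ be two probability densities on $\mathbb R$ with respect to a common reference measure $\nu$ (Lebesgue measure for density functions, counting measure for mass functions), and let $$H^2(f_g,f_r)=\tfrac12\int\bigl(\sqrt{f_g}-\sqrt{f_r}\bigr)^2\,d\nu$$ be their squared Hellinger divergence. A similarity matrix $W=(w_{u,v})_{u<v}$ is observed. Its entries are independent; $w_{u,v}$ has density $f_g$ if $u,v$ lie in the same cluster and $f_r$ otherwise. A randomized algorithm may know $n,k,f_g,f_r$. It sees $W$ and its own random seed, adaptively asks a perfect oracle questions of the form "are $u$ and $v$ in the same cluster?", and finally returns a partition of $V$. **Theorem 1.** For every $\eta<1$ there are constants $c,\delta>0$, depending only on $\eta$, such that the following holds for all $n,k$ with $3\le k<n$ and all $f_g,f_r$ with $H^2(f_g,f_r)\le\eta$. If the expected number of queries of a randomized algorithm is, for every true partition into $k$ clusters, less than $$c\,\min\Bigl\{\frac{k^2}{H^2(f_g,f_r)},\,nk\Bigr\}$$ (where $k^2/0=\infty$), then there is a partition $C$ of $V$ into exactly $k$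 nonempty clusters such that, when $C$ is the true partition, the algorithm fails to return $C$ with probability at least $\delta$. In particular this holds for every algorithm that always asks fewer than $c\min\{k^2/H^2(f_g,f_r),nk\}$ queries. -/

import Mathlib

open MeasureTheory
open scoped ENNReal

noncomputable section

/-- An adaptive query strategy on the element set `V`, as a decision tree: it either stops and
returns a clustering of `V` (an equivalence relation whose classes are the clusters), or asks the
oracle about a pair `(u, v)` and continues according to the yes/no answer. -/
inductive QueryTree (V : Type) : Type where
  | output (D : Setoid V) : QueryTree V
  | query (u v : V) (next : Bool → QueryTree V) : QueryTree V

namespace QueryTree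

open Classical in
/-- The clustering returned when the true clustering is `C`; the (perfect) oracle answers a query
`(u, v)` by telling whether `u` and `v` lie in the same cluster of `C`. -/
def result {V : Type} (C : Setoid V) : QueryTree V → Setoid V
  | output D => D
  | query u v next => result C (next (decide (C u v)))

open Classical in
/-- The number of queries asked before stopping when the true clustering is `C`. -/
def numQueries {V : Type} (C : Setoid V) : QueryTree V → ℕ
  | output _ => 0
  | query u v next => numQueries C (next (decide (C u v))) + 1

/-- There are only countably many decision trees on a finite set, so they carry the discrete
sigma-algebra. -/
instance (V : Type) : MeasurableSpace (QueryTree V) := ⊤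

end QueryTree

/-- The unordered pairs of distinct elements of `{0, …, n - 1}`. -/
abbrev Pairs (n : ℕ) : Type := {p : Fin n × Fin n // p.1 < p.2}

/-- A similarity matrix: one similarity value for every unordered pair of distinct elements. -/
abbrev SimMatrix (n : ℕ) : Type := Pairs n → ℝ

/-- `f` is a probability density with respect to the reference measure `ν` on the line
(`ν = volume` for density functions, `ν = Measure.count` for mass functions). -/
structure IsProbDensity (ν : Measure ℝ) (f : ℝ → ℝ) : Prop where
  measurable : Measurable f
  nonneg : ∀ x, 0 ≤ f x
  lintegral_eq_one : ∫⁻ x, ENNReal.ofReal (f x) ∂ν = 1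

/-- The squared Hellinger divergence `½ ∫ (√f - √g)² dν`. -/
def hellingerSq (ν : Measure ℝ) (f g : ℝ → ℝ) : ℝ :=
  (1 / 2) * ∫ x, (Real.sqrt (f x) - Real.sqrt (g x)) ^ 2 ∂ν

open Classical in
/-- The law of the similarity matrix when the true clustering is `C`: the entries are independent,
with density `fg` for pairs inside a cluster and density `fr` for pairs across clusters. -/
def simLaw {n : ℕ} (ν : Measure ℝ) (fg fr : ℝ → ℝ) (C : Setoid (Fin n)) :
    Measure (SimMatrix n) :=
  Measure.pi fun p : Pairs n =>
    ν.withDensity fun x => ENNReal.ofReal (if C p.1.1 p.1.2 then fg x else fr x)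

/-- The number of clusters of a clustering. -/
def numClusters {n : ℕ} (C : Setoid (Fin n)) : ℕ := Nat.card (Quotient C)

/-- The expected number of queries, when the true clustering is `C`, of the randomized algorithm
that draws a seed `s` from `P`, sees the similarity matrix `W` and then follows `A s W`. -/
def expectedQueries {n : ℕ} {S : Type*} [MeasurableSpace S] (ν : Measure ℝ) (fg fr : ℝ → ℝ)
    (P : Measure S) (A : S → SimMatrix n → QueryTree (Fin n)) (C : Setoid (Fin n)) : ℝ≥0∞ :=
  ∫⁻ p, ((A p.1 p.2).numQueries C : ℝ≥0∞) ∂(P.prod (simLaw ν fg fr C))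

/-- The probability that this algorithm does not return the true clustering `C`. -/
def errorProb {n : ℕ} {S : Type*} [MeasurableSpace S] (ν : Measure ℝ) (fg fr : ℝ → ℝ)
    (P : Measure S) (A : S → SimMatrix n → QueryTree (Fin n)) (C : Setoid (Fin n)) : ℝ≥0∞ :=
  (P.prod (simLaw ν fg fr C)) {p | (A p.1 p.2).result C ≠ C}

end

/-!
A strategy has to find the place of a hidden object by querying, whenever the similarity matrix
leaves the candidates for this place partly indistinguishable.

Let `C₀` be a clustering with one cluster too many, and let `C i` arise from it by a change at a set
of pairs, such that these sets are disjoint for different `i`. Run the strategy under `C₀` for `L`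
relevant queries. Each query reveals a change for at most one `i`, so at most `L` of the `C i` are
told apart from `C₀` (`QueryTree.sum_separates_le`), and for the other ones the run under `C i` is
the same, either to its end or until it has exceeded `L` relevant queries
(`QueryTree.result_eq_or_lt_countQueries`). The laws of the matrix under `C₀`, `C i` and `C j` have
a common part `Q`, the measure whose density is the minimum of the three densities. By Hölder's
inequality, its mass is at least `(1 - H²) ^ (4 N) / 9`, where `N` is the number of pairs affected
(`exists_common_part`). If `Q` has mass at least `γ` while the number of relevant queries is on
average below a small multiple of the number of candidates, then for suitable `i ≠ j` a part of `Q`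
of positive mass, bounded below in terms of `γ`, remains where the runs under `C i` and `C j` return
the same answer, which is wrong for one of them (`exists_le_errorProb`). Comparing through a common
part of three laws, rather than through total variation distances, is what makes the argument work
for `H²` close to one.

Two families of candidates are needed.

* If `n ≤ 2 k`, all of `0, …, k - 1` are singletons of `C₀`, the other elements form a cluster, and
  two of the singletons are merged. There are about `k²` candidates, and one pair is affected by
  each (`exists_le_errorProb_of_le_two_mul`).
* If `n > 2 k`, about `m = min (n, k / H²)` elements are placed uniformly at random in `k - 1`
  clusters. A query involves only two elements, so some element `v` is involved in no more than
  about a `2 / m` share of all queries, while it has `k - 1` candidate clusters of average size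
  `O(1 / H²)`, so that `N H²` is bounded (`exists_le_errorProb_of_free`).
-/

/-! ### Densities of product measures -/

theorem lintegral_pi_prod_eq {ι : Type*} [Fintype ι] {X : ι → Type*}
    [∀ i, MeasurableSpace (X i)] (μ : ∀ i, Measure (X i)) [∀ i, IsProbabilityMeasure (μ i)]
    (f : ∀ i, X i → ℝ≥0∞) (hf : ∀ i, Measurable (f i)) :
    ∫⁻ x, ∏ i, f i (x i) ∂(Measure.pi μ) = ∏ i, ∫⁻ x, f i x ∂(μ i) := by
  have h := ProbabilityTheory.lintegral_prod_eq_prod_lintegral_of_indepFun Finset.univ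
    (fun i (x : ∀ i, X i) => f i (x i))
    (ProbabilityTheory.iIndepFun_pi (μ := μ) (X := f) fun i => (hf i).aemeasurable)
    fun i => (hf i).comp (measurable_pi_apply i)
  rw [h]
  refine Finset.prod_congr rfl fun i _ => ?_
  exact (measurePreserving_eval μ i).lintegral_comp (hf i)

theorem pi_withDensity_eq {ι : Type*} [Fintype ι] {X : ι → Type*}
    [∀ i, MeasurableSpace (X i)] (μ : ∀ i, Measure (X i)) [∀ i, IsProbabilityMeasure (μ i)]
    (f : ∀ i, X i → ℝ≥0∞) (hf : ∀ i, Measurable (f i))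
    [∀ i, SigmaFinite ((μ i).withDensity (f i))] :
    Measure.pi (fun i => (μ i).withDensity (f i)) =
      (Measure.pi μ).withDensity fun x => ∏ i, f i (x i) := by
  refine Measure.pi_eq (μ := fun i => (μ i).withDensity (f i)) (fun s hs => ?_)
  rw [withDensity_apply _ (MeasurableSet.univ_pi hs),
    ← lintegral_indicator (MeasurableSet.univ_pi hs)]
  have : ∀ x : ∀ i, X i, (Set.univ.pi s).indicator (fun x => ∏ i, f i (x i)) x =
      ∏ i, (s i).indicator (f i) (x i) := by
    intro x
    by_cases hx : x ∈ Set.univ.pi s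
    · rw [Set.indicator_of_mem hx]
      exact Finset.prod_congr rfl fun i _ => (Set.indicator_of_mem (hx i trivial) _).symm
    · rw [Set.indicator_of_notMem hx]
      simp only [Set.mem_pi, Set.mem_univ, true_implies, not_forall] at hx
      obtain ⟨i, hi⟩ := hx
      exact (Finset.prod_eq_zero (Finset.mem_univ i) (Set.indicator_of_notMem hi _)).symm
  simp_rw [this]
  rw [lintegral_pi_prod_eq μ _ fun i => (hf i).indicator (hs i)]
  refine Finset.prod_congr rfl fun i _ => ?_
  rw [lintegral_indicator (hs i), withDensity_apply _ (hs i)]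

/-! ### Overlap of probability densities -/

/-- Hölder's inequality: the geometric mean of `a`, `a`, `b` has large mass if that of `a`, `b`
has. -/
theorem affinity_pow_le {α : Type*} [MeasurableSpace α] (μ : Measure α) {a b : α → ℝ≥0∞}
    (ha : Measurable a) (hb : Measurable b) (hb1 : ∫⁻ x, b x ∂μ = 1) :
    (∫⁻ x, (a x * b x) ^ (1 / 2 : ℝ) ∂μ) ^ 4 ≤
      (∫⁻ x, (a x * (a x * b x)) ^ (1 / 3 : ℝ) ∂μ) ^ 3 := by
  have hpq : (4 / 3 : ℝ).HolderConjugate 4 :=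
    Real.holderConjugate_iff.mpr ⟨by norm_num, by norm_num⟩
  have key := ENNReal.lintegral_mul_le_Lp_mul_Lq μ hpq
    (f := fun x => (a x * (a x * b x)) ^ (1 / 4 : ℝ)) (g := fun x => b x ^ (1 / 4 : ℝ))
    (by fun_prop) (by fun_prop)
  have e1 : ∀ x, ((fun x => (a x * (a x * b x)) ^ (1 / 4 : ℝ)) * fun x => b x ^ (1 / 4 : ℝ)) x =
      (a x * b x) ^ (1 / 2 : ℝ) := by
    intro x
    simp only [Pi.mul_apply]
    rw [← ENNReal.mul_rpow_of_nonneg _ _ (by norm_num),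
      show a x * (a x * b x) * b x = (a x * b x) ^ (2 : ℝ) by
        rw [ENNReal.rpow_two]; ring, ← ENNReal.rpow_mul]
    norm_num
  have e2 : ∀ x, ((a x * (a x * b x)) ^ (1 / 4 : ℝ)) ^ (4 / 3 : ℝ) =
      (a x * (a x * b x)) ^ (1 / 3 : ℝ) := by
    intro x; rw [← ENNReal.rpow_mul]; norm_num
  have e3 : ∀ x, (b x ^ (1 / 4 : ℝ)) ^ (4 : ℝ) = b x := by
    intro x; rw [← ENNReal.rpow_mul]; norm_num
  simp_rw [e1, e2, e3, hb1, ENNReal.one_rpow, mul_one] at key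
  calc _ ≤ _ := pow_le_pow_left' key 4
    _ = _ := by
      rw [← ENNReal.rpow_natCast, ← ENNReal.rpow_mul, ← ENNReal.rpow_natCast]
      norm_num

/-- Three probability densities overlap if their geometric mean has large mass: the latter is at
most `min ^ (1 / 3) * sum ^ (2 / 3)`, to which Hölder's inequality applies. -/
theorem geomMean_pow_le {α : Type*} [MeasurableSpace α] (μ : Measure α) {a b c : α → ℝ≥0∞}
    (ha : Measurable a) (hb : Measurable b) (hc : Measurable c)
    (ha1 : ∫⁻ x, a x ∂μ = 1) (hb1 : ∫⁻ x, b x ∂μ = 1) (hc1 : ∫⁻ x, c x ∂μ = 1) :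
    (∫⁻ x, (a x * (b x * c x)) ^ (1 / 3 : ℝ) ∂μ) ^ 3 ≤
      9 * ∫⁻ x, min (a x) (min (b x) (c x)) ∂μ := by
  have hpq : (3 : ℝ).HolderConjugate (3 / 2) :=
    Real.holderConjugate_iff.mpr ⟨by norm_num, by norm_num⟩
  have key := ENNReal.lintegral_mul_le_Lp_mul_Lq μ hpq
    (f := fun x => (min (a x) (min (b x) (c x))) ^ (1 / 3 : ℝ))
    (g := fun x => (a x + (b x + c x)) ^ (2 / 3 : ℝ))
    (by fun_prop) (by fun_prop)
  have e2 : ∀ x, ((min (a x) (min (b x) (c x))) ^ (1 / 3 : ℝ)) ^ (3 : ℝ) =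
      min (a x) (min (b x) (c x)) := by
    intro x; rw [← ENNReal.rpow_mul]; norm_num
  have e3 : ∀ x, ((a x + (b x + c x)) ^ (2 / 3 : ℝ)) ^ (3 / 2 : ℝ) = a x + (b x + c x) := by
    intro x; rw [← ENNReal.rpow_mul]; norm_num
  have e1 : ∀ x, (a x * (b x * c x)) ^ (1 / 3 : ℝ) ≤
      ((fun x => (min (a x) (min (b x) (c x))) ^ (1 / 3 : ℝ)) *
        fun x => (a x + (b x + c x)) ^ (2 / 3 : ℝ)) x := by
    intro x
    simp only [Pi.mul_apply]
    have : (a x + (b x + c x)) ^ (2 / 3 : ℝ) = ((a x + (b x + c x)) ^ 2) ^ (1 / 3 : ℝ) := by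
      rw [← ENNReal.rpow_two, ← ENNReal.rpow_mul]; norm_num
    rw [this, ← ENNReal.mul_rpow_of_nonneg _ _ (by norm_num)]
    refine ENNReal.rpow_le_rpow ?_ (by norm_num)
    set A := a x
    set B := b x
    set D := c x
    have hA : A ≤ A + (B + D) := le_self_add
    have hB : B ≤ A + (B + D) := le_add_left le_self_add
    have hD : D ≤ A + (B + D) := le_add_left le_add_self
    rw [sq]
    -- the smallest of the three factors is the minimum, the other two are below the sum
    rcases le_total A (min B D) with h | h
    · rw [min_eq_left h]; gcongr
    · rw [min_eq_right h]
      rcases le_total B D with h' | h'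
      · rw [min_eq_left h', mul_left_comm]; gcongr
      · rw [min_eq_right h', ← mul_assoc, mul_comm (A * B)]; gcongr
  have e4 : ∫⁻ x, a x + (b x + c x) ∂μ = 3 := by
    rw [lintegral_add_left ha, lintegral_add_left hb, ha1, hb1, hc1]; norm_num
  simp_rw [e2, e3, e4] at key
  calc _ ≤ _ := pow_le_pow_left' ((lintegral_mono e1).trans key) 3
    _ = _ := by
      rw [mul_pow, ← ENNReal.rpow_natCast, ← ENNReal.rpow_mul, ← ENNReal.rpow_natCast,
        ← ENNReal.rpow_mul]
      norm_num
      rw [mul_comm]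

/-! ### The Hellinger affinity -/

theorem hellingerSq_nonneg (ν : Measure ℝ) (f g : ℝ → ℝ) : 0 ≤ hellingerSq ν f g :=
  mul_nonneg (by norm_num) (integral_nonneg fun _ => sq_nonneg _)

theorem IsProbDensity.integrable {ν : Measure ℝ} {f : ℝ → ℝ} (hf : IsProbDensity ν f) :
    Integrable f ν := by
  refine ⟨hf.measurable.aestronglyMeasurable, ?_⟩
  rw [hasFiniteIntegral_iff_ofReal (Filter.Eventually.of_forall hf.nonneg), hf.lintegral_eq_one]
  exact ENNReal.one_lt_top

theorem IsProbDensity.integral_eq_one {ν : Measure ℝ} {f : ℝ → ℝ} (hf : IsProbDensity ν f) :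
    ∫ x, f x ∂ν = 1 := by
  rw [integral_eq_lintegral_of_nonneg_ae (Filter.Eventually.of_forall hf.nonneg)
    hf.measurable.aestronglyMeasurable, hf.lintegral_eq_one, ENNReal.toReal_one]

/-- The Hellinger affinity is one minus the squared Hellinger divergence. -/
theorem lintegral_sqrt_mul_eq {ν : Measure ℝ} {f g : ℝ → ℝ} (hf : IsProbDensity ν f)
    (hg : IsProbDensity ν g) :
    ∫⁻ x, (ENNReal.ofReal (f x) * ENNReal.ofReal (g x)) ^ (1 / 2 : ℝ) ∂ν =
      ENNReal.ofReal (1 - hellingerSq ν f g) := by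
  have hmf := hf.measurable
  have hmg := hg.measurable
  have hint : Integrable (fun x => √(f x) * √(g x)) ν := by
    refine (hf.integrable.add hg.integrable).mono' (by fun_prop) (.of_forall fun x => ?_)
    rw [Real.norm_of_nonneg (by positivity), Pi.add_apply]
    nlinarith [sq_nonneg (√(f x) - √(g x)), Real.sq_sqrt (hf.nonneg x), Real.sq_sqrt (hg.nonneg x),
      hf.nonneg x, hg.nonneg x]
  have hsq : ∀ x, (√(f x) - √(g x)) ^ 2 = f x + g x - 2 * (√(f x) * √(g x)) := fun x => by
    nlinarith [Real.sq_sqrt (hf.nonneg x), Real.sq_sqrt (hg.nonneg x)]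
  have hH : 1 - hellingerSq ν f g = ∫ x, √(f x) * √(g x) ∂ν := by
    have hfg : Integrable (fun x => f x + g x) ν := hf.integrable.add hg.integrable
    simp_rw [hellingerSq, hsq]
    rw [integral_sub hfg (hint.const_mul 2), integral_add hf.integrable hg.integrable,
      hf.integral_eq_one, hg.integral_eq_one, integral_const_mul]
    ring
  rw [hH, ofReal_integral_eq_lintegral_ofReal hint (.of_forall fun x => by positivity)]
  refine lintegral_congr fun x => ?_
  rw [← ENNReal.ofReal_mul (hf.nonneg x), ← Real.sqrt_mul (hf.nonneg x), Real.sqrt_eq_rpow,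
    ENNReal.ofReal_rpow_of_nonneg (mul_nonneg (hf.nonneg x) (hg.nonneg x)) (by norm_num)]

/-- The even mixture of the laws with densities `f` and `g`. It replaces `ν` as the reference
measure, since `ν` need not be σ-finite (counting measure on the line is not). -/
noncomputable def midMeasure (ν : Measure ℝ) (f g : ℝ → ℝ) : Measure ℝ :=
  ν.withDensity fun x => ENNReal.ofReal ((f x + g x) / 2)

/-- The density of `f` with respect to `midMeasure ν f g` or `midMeasure ν g f`. -/
noncomputable def relDensity (f g : ℝ → ℝ) (x : ℝ) : ℝ≥0∞ :=
  ENNReal.ofReal (f x / ((f x + g x) / 2))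

section Mid
variable {ν : Measure ℝ} {f g : ℝ → ℝ}

theorem midMeasure_comm : midMeasure ν f g = midMeasure ν g f := by
  simp only [midMeasure, add_comm]

theorem isProbabilityMeasure_midMeasure (hf : IsProbDensity ν f) (hg : IsProbDensity ν g) :
    IsProbabilityMeasure (midMeasure ν f g) := by
  constructor
  have : ∀ x, ENNReal.ofReal ((f x + g x) / 2) =
      2⁻¹ * (ENNReal.ofReal (f x) + ENNReal.ofReal (g x)) := fun x => by
    rw [← ENNReal.ofReal_add (hf.nonneg x) (hg.nonneg x), div_eq_inv_mul,
      ENNReal.ofReal_mul (by norm_num), ENNReal.ofReal_inv_of_pos (by norm_num)]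
    norm_num
  have hmf := hf.measurable
  have hmg := hg.measurable
  rw [midMeasure, withDensity_apply _ MeasurableSet.univ, Measure.restrict_univ]
  simp_rw [this]
  rw [lintegral_const_mul _ (by fun_prop), lintegral_add_left (by fun_prop), hf.lintegral_eq_one,
    hg.lintegral_eq_one, one_add_one_eq_two, ENNReal.inv_mul_cancel (by norm_num) (by norm_num)]

theorem measurable_relDensity (hf : IsProbDensity ν f) (hg : IsProbDensity ν g) :
    Measurable (relDensity f g) := by
  have hmf := hf.measurable
  have hmg := hg.measurable
  unfold relDensity
  fun_prop

theorem mid_mul_relDensity (hf : IsProbDensity ν f) (hg : IsProbDensity ν g) (x : ℝ) :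
    ENNReal.ofReal ((f x + g x) / 2) * relDensity f g x = ENNReal.ofReal (f x) := by
  have h1 := hf.nonneg x
  have h2 := hg.nonneg x
  rw [relDensity, ← ENNReal.ofReal_mul (by positivity)]
  congr 1
  rcases eq_or_ne ((f x + g x) / 2) 0 with h | h
  · rw [h]; linarith
  · exact mul_div_cancel₀ _ h

theorem midMeasure_withDensity (hf : IsProbDensity ν f) (hg : IsProbDensity ν g) :
    (midMeasure ν f g).withDensity (relDensity f g) =
      ν.withDensity fun x => ENNReal.ofReal (f x) := by
  have hmf := hf.measurable
  have hmg := hg.measurable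
  rw [midMeasure, ← withDensity_mul _ (by fun_prop) (measurable_relDensity hf hg)]
  congr 1
  ext x
  exact mid_mul_relDensity hf hg x

theorem lintegral_relDensity (hf : IsProbDensity ν f) (hg : IsProbDensity ν g) :
    ∫⁻ x, relDensity f g x ∂(midMeasure ν f g) = 1 := by
  rw [← setLIntegral_univ, ← withDensity_apply _ MeasurableSet.univ, midMeasure_withDensity hf hg,
    withDensity_apply _ MeasurableSet.univ, setLIntegral_univ, hf.lintegral_eq_one]

theorem affinity_midMeasure (hf : IsProbDensity ν f) (hg : IsProbDensity ν g) :
    ∫⁻ x, (relDensity f g x * relDensity g f x) ^ (1 / 2 : ℝ) ∂(midMeasure ν f g) =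
      ENNReal.ofReal (1 - hellingerSq ν f g) := by
  have hmf := hf.measurable
  have hmg := hg.measurable
  have hm1 := measurable_relDensity hf hg
  have hm2 := measurable_relDensity hg hf
  rw [← lintegral_sqrt_mul_eq hf hg, midMeasure,
    lintegral_withDensity_eq_lintegral_mul _ (by fun_prop) (by fun_prop)]
  refine lintegral_congr fun x => ?_
  rw [Pi.mul_apply, ← mid_mul_relDensity hf hg x, ← mid_mul_relDensity hg hf x, add_comm (g x)]
  set s := ENNReal.ofReal ((f x + g x) / 2)
  rw [show s * relDensity f g x * (s * relDensity g f x) =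
    s ^ (2 : ℝ) * (relDensity f g x * relDensity g f x) by rw [ENNReal.rpow_two]; ring,
    ENNReal.mul_rpow_of_nonneg (s ^ (2 : ℝ)) _ (by norm_num), ← ENNReal.rpow_mul]
  norm_num

end Mid

/-! ### The law of the similarity matrix -/

open Classical in
/-- The density, with respect to `midMeasure ν fg fr`, of the similarity of a pair which lies in a
common cluster iff `c` holds. -/
noncomputable def cellDensity (fg fr : ℝ → ℝ) (c : Prop) : ℝ → ℝ≥0∞ :=
  if c then relDensity fg fr else relDensity fr fg

/-- The density of `simLaw ν fg fr C` with respect to the product of copies of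
`midMeasure ν fg fr`. -/
noncomputable def simDensity {n : ℕ} (fg fr : ℝ → ℝ) (C : Setoid (Fin n)) (W : SimMatrix n) :
    ℝ≥0∞ :=
  ∏ p, cellDensity fg fr (C p.1.1 p.1.2) (W p)

section Density
variable {ν : Measure ℝ} {fg fr : ℝ → ℝ}

theorem measurable_cellDensity (hg : IsProbDensity ν fg) (hr : IsProbDensity ν fr) (c : Prop) :
    Measurable (cellDensity fg fr c) := by
  unfold cellDensity
  split_ifs
  exacts [measurable_relDensity hg hr, measurable_relDensity hr hg]

theorem lintegral_cellDensity (hg : IsProbDensity ν fg) (hr : IsProbDensity ν fr) (c : Prop) :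
    ∫⁻ x, cellDensity fg fr c x ∂(midMeasure ν fg fr) = 1 := by
  unfold cellDensity
  split_ifs
  exacts [lintegral_relDensity hg hr, midMeasure_comm (ν := ν) ▸ lintegral_relDensity hr hg]

/-- Hölder's inequality on a single entry of the matrix: three laws of the entry have a geometric
mean of large mass. -/
theorem affinity_pow_le_cellDensity (hg : IsProbDensity ν fg) (hr : IsProbDensity ν fr)
    (c₀ c₁ c₂ : Prop) :
    ENNReal.ofReal (1 - hellingerSq ν fg fr) ^ 4 ≤
      (∫⁻ x, (cellDensity fg fr c₀ x * (cellDensity fg fr c₁ x * cellDensity fg fr c₂ x))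
        ^ (1 / 3 : ℝ) ∂(midMeasure ν fg fr)) ^ 3 := by
  have hA : ENNReal.ofReal (1 - hellingerSq ν fg fr) ≤ 1 :=
    ENNReal.ofReal_le_one.2 (by linarith [hellingerSq_nonneg ν fg fr])
  have hr1 : ∫⁻ x, relDensity fr fg x ∂(midMeasure ν fg fr) = 1 :=
    midMeasure_comm (ν := ν) ▸ lintegral_relDensity hr hg
  have hg1 := lintegral_relDensity hg hr
  have h1 := affinity_pow_le (midMeasure ν fg fr) (measurable_relDensity hg hr)
    (measurable_relDensity hr hg) hr1
  have h2 := affinity_pow_le (midMeasure ν fg fr) (measurable_relDensity hr hg)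
    (measurable_relDensity hg hr) hg1
  simp_rw [mul_comm (relDensity fr fg _) (relDensity fg fr _)] at h2
  rw [affinity_midMeasure hg hr] at h1 h2
  have cube : ∀ u : ℝ≥0∞, (u * (u * u)) ^ (1 / 3 : ℝ) = u := fun u => by
    rw [show u * (u * u) = u ^ (3 : ℝ) by norm_cast; ring, ← ENNReal.rpow_mul]
    norm_num
  by_cases hc₀ : c₀ <;> by_cases hc₁ : c₁ <;> by_cases hc₂ : c₂ <;>
    simp only [cellDensity, hc₀, hc₁, hc₂, if_true, if_false, cube]
  · rw [hg1, one_pow]; exact pow_le_one' hA 4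
  · exact h1
  · simp_rw [mul_comm (relDensity fr fg _) (relDensity fg fr _)]; exact h1
  · simp_rw [mul_left_comm (relDensity fg fr _) (relDensity fr fg _)]; exact h2
  · simp_rw [mul_left_comm (relDensity fr fg _) (relDensity fg fr _) (relDensity fg fr _),
      mul_comm (relDensity fr fg _) (relDensity fg fr _)]; exact h1
  · exact h2
  · simp_rw [mul_comm (relDensity fr fg _) (relDensity fg fr _)]; exact h2
  · rw [hr1, one_pow]; exact pow_le_one' hA 4

theorem geomMean_cellDensity_self (hg : IsProbDensity ν fg) (hr : IsProbDensity ν fr) (c : Prop) :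
    ∫⁻ x, (cellDensity fg fr c x * (cellDensity fg fr c x * cellDensity fg fr c x))
        ^ (1 / 3 : ℝ) ∂(midMeasure ν fg fr) = 1 := by
  have cube : ∀ u : ℝ≥0∞, (u * (u * u)) ^ (1 / 3 : ℝ) = u := fun u => by
    rw [show u * (u * u) = u ^ (3 : ℝ) by norm_cast; ring, ← ENNReal.rpow_mul]
    norm_num
  simp_rw [cube]
  exact lintegral_cellDensity hg hr c

variable {n : ℕ}

theorem measurable_simDensity (hg : IsProbDensity ν fg) (hr : IsProbDensity ν fr)
    (C : Setoid (Fin n)) : Measurable (simDensity fg fr C) := by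
  have := measurable_cellDensity hg hr
  unfold simDensity
  fun_prop

theorem simLaw_eq_withDensity (hg : IsProbDensity ν fg) (hr : IsProbDensity ν fr)
    (C : Setoid (Fin n)) :
    simLaw ν fg fr C =
      (Measure.pi fun _ : Pairs n => midMeasure ν fg fr).withDensity (simDensity fg fr C) := by
  have := isProbabilityMeasure_midMeasure hg hr
  have hcell : ∀ c : Prop, IsProbabilityMeasure
      ((midMeasure ν fg fr).withDensity (cellDensity fg fr c)) := fun c => ⟨by
    rw [withDensity_apply _ MeasurableSet.univ, setLIntegral_univ, lintegral_cellDensity hg hr]⟩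
  rw [simLaw]
  have : ∀ p : Pairs n, (ν.withDensity fun x =>
      ENNReal.ofReal (open Classical in if C p.1.1 p.1.2 then fg x else fr x)) =
      (midMeasure ν fg fr).withDensity (cellDensity fg fr (C p.1.1 p.1.2)) := by
    intro p
    unfold cellDensity
    split_ifs
    · exact (midMeasure_withDensity hg hr).symm
    · rw [midMeasure_comm]; exact (midMeasure_withDensity hr hg).symm
  simp_rw [this]
  exact pi_withDensity_eq _ _ fun p => measurable_cellDensity hg hr _

theorem lintegral_simDensity (hg : IsProbDensity ν fg) (hr : IsProbDensity ν fr)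
    (C : Setoid (Fin n)) :
    ∫⁻ W, simDensity fg fr C W ∂(Measure.pi fun _ : Pairs n => midMeasure ν fg fr) = 1 := by
  have := isProbabilityMeasure_midMeasure hg hr
  unfold simDensity
  rw [lintegral_pi_prod_eq _ _ fun p => measurable_cellDensity hg hr _]
  simp_rw [lintegral_cellDensity hg hr, Finset.prod_const_one]

theorem isProbabilityMeasure_simLaw (hg : IsProbDensity ν fg) (hr : IsProbDensity ν fr)
    (C : Setoid (Fin n)) : IsProbabilityMeasure (simLaw ν fg fr C) := ⟨by
  rw [simLaw_eq_withDensity hg hr, withDensity_apply _ MeasurableSet.univ, setLIntegral_univ,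
    lintegral_simDensity hg hr]⟩

open Classical in
/-- The laws of the seed and the similarity matrix under three clusterings that disagree on few
pairs have a common part of mass bounded below: the measure whose density is the minimum of the
three densities. -/
theorem exists_common_part (hg : IsProbDensity ν fg) (hr : IsProbDensity ν fr)
    {S : Type*} [MeasurableSpace S] (P : Measure S) [IsProbabilityMeasure P]
    (C₀ C₁ C₂ : Setoid (Fin n)) {N : ℕ}
    (hN : (Finset.univ.filter fun p : Pairs n =>
      ¬ ((C₁ p.1.1 p.1.2 ↔ C₀ p.1.1 p.1.2) ∧ (C₂ p.1.1 p.1.2 ↔ C₀ p.1.1 p.1.2))).card ≤ N) :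
    ∃ Q : Measure (S × SimMatrix n),
      Q ≤ P.prod (simLaw ν fg fr C₀) ∧ Q ≤ P.prod (simLaw ν fg fr C₁) ∧
      Q ≤ P.prod (simLaw ν fg fr C₂) ∧
      ENNReal.ofReal (1 - hellingerSq ν fg fr) ^ (4 * N) ≤ 9 * Q Set.univ := by
  have := isProbabilityMeasure_midMeasure hg hr
  set μ := Measure.pi fun _ : Pairs n => midMeasure ν fg fr with hμ
  have hm := measurable_simDensity (n := n) hg hr
  have hlaw : ∀ C : Setoid (Fin n), P.prod (simLaw ν fg fr C) =
      (P.prod μ).withDensity fun z => simDensity fg fr C z.2 := fun C => by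
    have := isProbabilityMeasure_simLaw hg hr C
    rw [simLaw_eq_withDensity hg hr] at this ⊢
    exact prod_withDensity_right (hm C)
  have hA : ENNReal.ofReal (1 - hellingerSq ν fg fr) ≤ 1 :=
    ENNReal.ofReal_le_one.2 (by linarith [hellingerSq_nonneg ν fg fr])
  refine ⟨(P.prod μ).withDensity fun z => min (simDensity fg fr C₀ z.2)
    (min (simDensity fg fr C₁ z.2) (simDensity fg fr C₂ z.2)), ?_, ?_, ?_, ?_⟩
  · rw [hlaw]; exact withDensity_mono (.of_forall fun z => min_le_left _ _)
  · rw [hlaw]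
    exact withDensity_mono (.of_forall fun z => (min_le_right _ _).trans (min_le_left _ _))
  · rw [hlaw]
    exact withDensity_mono (.of_forall fun z => (min_le_right _ _).trans (min_le_right _ _))
  rw [withDensity_apply _ MeasurableSet.univ, setLIntegral_univ,
    lintegral_prod _ (by fun_prop)]
  dsimp only
  rw [lintegral_const, measure_univ, mul_one]
  refine le_trans ?_ (geomMean_pow_le μ (hm C₀) (hm C₁) (hm C₂) (lintegral_simDensity hg hr C₀)
    (lintegral_simDensity hg hr C₁) (lintegral_simDensity hg hr C₂))
  have hprod : ∀ W : SimMatrix n,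
      (simDensity fg fr C₀ W * (simDensity fg fr C₁ W * simDensity fg fr C₂ W)) ^ (1 / 3 : ℝ) =
      ∏ p, (cellDensity fg fr (C₀ p.1.1 p.1.2) (W p) * (cellDensity fg fr (C₁ p.1.1 p.1.2) (W p) *
        cellDensity fg fr (C₂ p.1.1 p.1.2) (W p))) ^ (1 / 3 : ℝ) := fun W => by
    rw [ENNReal.prod_rpow_of_nonneg (by norm_num), Finset.prod_mul_distrib,
      Finset.prod_mul_distrib]
    rfl
  simp_rw [hprod]
  have hmc := measurable_cellDensity hg hr
  rw [lintegral_pi_prod_eq (fun _ : Pairs n => midMeasure ν fg fr)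
    (fun p x => (cellDensity fg fr (C₀ p.1.1 p.1.2) x * (cellDensity fg fr (C₁ p.1.1 p.1.2) x *
        cellDensity fg fr (C₂ p.1.1 p.1.2) x)) ^ (1 / 3 : ℝ)) (fun p => by fun_prop),
    ← Finset.prod_pow]
  calc ENNReal.ofReal (1 - hellingerSq ν fg fr) ^ (4 * N)
      ≤ (ENNReal.ofReal (1 - hellingerSq ν fg fr) ^ 4) ^ (Finset.univ.filter fun p : Pairs n =>
          ¬ ((C₁ p.1.1 p.1.2 ↔ C₀ p.1.1 p.1.2) ∧ (C₂ p.1.1 p.1.2 ↔ C₀ p.1.1 p.1.2))).card := by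
        rw [← pow_mul]
        exact pow_le_pow_right_of_le_one' hA (by gcongr)
    _ = ∏ p : Pairs n, if ¬ ((C₁ p.1.1 p.1.2 ↔ C₀ p.1.1 p.1.2) ∧ (C₂ p.1.1 p.1.2 ↔ C₀ p.1.1 p.1.2))
          then ENNReal.ofReal (1 - hellingerSq ν fg fr) ^ 4 else 1 := by
        rw [← Finset.prod_const, Finset.prod_filter]
    _ ≤ _ := by
        refine Finset.prod_le_prod' fun p _ => ?_
        split_ifs with h
        · rw [propext h.1, propext h.2, geomMean_cellDensity_self hg hr, one_pow]
        · exact affinity_pow_le_cellDensity hg hr _ _ _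

end Density

/-! ### Runs of a query strategy under two clusterings -/

namespace QueryTree

variable {V : Type}

open Classical in
/-- The number of queries `(u, v)` with `U u v` asked when the true clustering is `C`. -/
noncomputable def countQueries (U : V → V → Prop) (C : Setoid V) : QueryTree V → ℕ
  | output _ => 0
  | query u v next =>
    countQueries U C (next (decide (C u v))) + if U u v then 1 else 0

open Classical in
/-- Among the first `L` queries satisfying `U` that are asked when the true clustering is `C₀`,
there is one that `C` answers differently. -/
def Separates (U : V → V → Prop) (C₀ C : Setoid V) : ℕ → QueryTree V → Prop
  | _, output _ => False
  | 0, query _ _ _ => False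
  | L + 1, query u v next =>
    if U u v then ¬ (C u v ↔ C₀ u v) ∨ Separates U C₀ C L (next (decide (C₀ u v)))
    else Separates U C₀ C (L + 1) (next (decide (C₀ u v)))

theorem countQueries_true (C : Setoid V) (t : QueryTree V) :
    t.countQueries (fun _ _ => True) C = t.numQueries C := by
  induction t with
  | output D => rfl
  | query u v next ih => simp [countQueries, numQueries, ih]

/-- A query involves at most two elements. -/
theorem sum_countQueries_le {ι : Type*} [Fintype ι] {e : ι → V} (he : Function.Injective e)
    (C : Setoid V) (t : QueryTree V) :
    ∑ i, t.countQueries (fun u v => u = e i ∨ v = e i) C ≤ 2 * t.numQueries C := by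
  classical
  induction t with
  | output D => simp [countQueries]
  | query u v next ih =>
    have hone : ∀ w : V, ∑ i, (if w = e i then 1 else 0) ≤ 1 := fun w => by
      rw [Finset.sum_boole]
      refine Nat.cast_id _ ▸ Finset.card_le_one.2 fun i hi j hj => he ?_
      rw [← (Finset.mem_filter.1 hi).2, ← (Finset.mem_filter.1 hj).2]
    have hsplit : ∑ i, (if u = e i ∨ v = e i then 1 else 0) ≤
        ∑ i, (if u = e i then 1 else 0) + ∑ i, (if v = e i then 1 else 0) := by
      rw [← Finset.sum_add_distrib]
      refine Finset.sum_le_sum fun i _ => ?_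
      by_cases h1 : u = e i <;> by_cases h2 : v = e i <;> simp [h1, h2]
    simp only [countQueries, numQueries, Finset.sum_add_distrib, mul_add]
    refine Nat.add_le_add (ih _) ?_
    have htwo := hsplit.trans (Nat.add_le_add (hone u) (hone v))
    refine le_trans (le_of_eq ?_) htwo
    exact Finset.sum_congr rfl fun i _ => by congr

/-- Each of the first `L` relevant queries separates at most one of the clusterings from `C₀`. -/
theorem sum_separates_le {ι : Type*} [Fintype ι] {U : V → V → Prop} {C₀ : Setoid V}
    {C : ι → Setoid V}
    (hC : ∀ u v i j, ¬ (C i u v ↔ C₀ u v) → ¬ (C j u v ↔ C₀ u v) → i = j)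
    (L : ℕ) (t : QueryTree V) :
    Nat.card {i // Separates U C₀ (C i) L t} ≤ L := by
  classical
  rw [Nat.card_eq_fintype_card, Fintype.card_subtype]
  induction t generalizing L with
  | output D =>
    rw [Finset.card_eq_zero.2 (Finset.filter_eq_empty_iff.2 fun i _ => by cases L <;> exact id)]
    exact L.zero_le
  | query u v next ih =>
    cases L with
    | zero =>
      rw [Finset.card_eq_zero.2 (Finset.filter_eq_empty_iff.2 fun i _ => by exact id)]
    | succ L =>
      by_cases hU : U u v
      · simp only [Separates, hU, if_true, Finset.filter_or]
        refine (Finset.card_union_le _ _).trans ?_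
        have h1 : (Finset.univ.filter fun i => ¬ (C i u v ↔ C₀ u v)).card ≤ 1 :=
          Finset.card_le_one.2 fun i hi j hj =>
            hC u v i j (Finset.mem_filter.1 hi).2 (Finset.mem_filter.1 hj).2
        have h2 := ih (decide (C₀ u v)) L
        omega
      · simpa only [Separates, hU, if_false] using ih (decide (C₀ u v)) (L + 1)

variable {U : V → V → Prop} {C₀ C : Setoid V}

/-- If the first `L` queries in `U` do not separate `C` from `C₀`, then either both runs are the
same, or both ask more than `L` queries in `U`. The second case matters because no bound is known
on the number of queries asked under `C₀`. -/
theorem result_eq_or_lt_countQueries (hU : ∀ u v, ¬ (C u v ↔ C₀ u v) → U u v) {L : ℕ}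
    {t : QueryTree V} (h : ¬ Separates U C₀ C L t) :
    (t.countQueries U C₀ ≤ L → t.result C = t.result C₀) ∧
      (L < t.countQueries U C₀ → L < t.countQueries U C) := by
  classical
  induction t generalizing L with
  | output D => exact ⟨fun _ => rfl, fun h => by simp [countQueries] at h⟩
  | query u v next ih =>
    by_cases huv : U u v
    · cases L with
      | zero => simp [countQueries, huv]
      | succ L =>
        simp only [Separates, huv, if_true, not_or, not_not] at h
        obtain ⟨h1, h2⟩ := ih _ h.2
        simp only [countQueries, result, huv, if_true, h.1]
        exact ⟨fun h => h1 (by omega), fun h => by have := h2 (by omega); omega⟩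
    · have hiff : C u v ↔ C₀ u v := not_not.1 fun h' => huv (hU u v h')
      have h' : ¬ Separates U C₀ C L (next (decide (C₀ u v))) := by
        cases L with
        | zero => cases next (decide (C₀ u v)) <;> simp [Separates]
        | succ L => simpa only [Separates, huv, if_false] using h
      simpa only [countQueries, result, huv, if_false, hiff, add_zero] using ih _ h'

end QueryTree

/-! ### Local modifications of one clustering -/

theorem exists_pair_le_of_sum_le {ι : Type*} [Fintype ι] (hι : 2 ≤ Fintype.card ι) {f : ι → ℝ}
    (hf : ∀ i, 0 ≤ f i) {a : ℝ} (h : ∑ i, f i ≤ a * Fintype.card ι) :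
    ∃ i j, i ≠ j ∧ f i ≤ 2 * a ∧ f j ≤ 2 * a := by
  classical
  have hι' : (2 : ℝ) ≤ Fintype.card ι := by exact_mod_cast hι
  have ha : 0 ≤ a := by
    have := (Finset.sum_nonneg fun i _ => hf i).trans h
    nlinarith
  have hne : (Finset.univ : Finset ι).Nonempty :=
    Finset.card_pos.1 (by rw [Finset.card_univ]; omega)
  obtain ⟨i, -, hi⟩ := Finset.exists_le_of_sum_le (s := Finset.univ) (f := f) (g := fun _ => a) hne
    (by simpa [mul_comm] using h)
  have hcard : (Finset.univ.erase i).card = Fintype.card ι - 1 := by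
    rw [Finset.card_erase_of_mem (Finset.mem_univ i), Finset.card_univ]
  have hne' : (Finset.univ.erase i).Nonempty := Finset.card_pos.1 (by omega)
  obtain ⟨j, hj, hj'⟩ := Finset.exists_le_of_sum_le (s := Finset.univ.erase i) (f := f)
    (g := fun _ => 2 * a) hne' (by
      rw [Finset.sum_const, hcard, nsmul_eq_mul, Nat.cast_sub (by omega), Nat.cast_one]
      have := Finset.sum_le_sum_of_subset_of_nonneg (Finset.erase_subset i Finset.univ)
        (f := f) fun i _ _ => hf i
      nlinarith)
  exact ⟨i, j, (Finset.ne_of_mem_erase hj).symm, by linarith, hj'⟩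

/-- If no point lies in more than `L` of the events, their probabilities add up to at most `L`. -/
theorem sum_measureReal_le {Ω ι : Type*} [MeasurableSpace Ω] [Fintype ι] (μ : Measure Ω)
    [IsProbabilityMeasure μ] {E : ι → Set Ω} (hE : ∀ i, MeasurableSet (E i)) {L : ℕ}
    (hL : ∀ ω, Nat.card {i // ω ∈ E i} ≤ L) : ∑ i, μ.real (E i) ≤ L := by
  classical
  have h : ∑ i, μ (E i) ≤ L := by
    calc ∑ i, μ (E i) = ∫⁻ ω, ∑ i, (E i).indicator 1 ω ∂μ := by
          rw [lintegral_finsetSum _ fun i _ => measurable_one.indicator (hE i)]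
          exact Finset.sum_congr rfl fun i _ => (lintegral_indicator_one (hE i)).symm
      _ ≤ ∫⁻ _, (L : ℝ≥0∞) ∂μ := by
          refine lintegral_mono fun ω => ?_
          have := hL ω
          rw [Nat.card_eq_fintype_card, Fintype.card_subtype] at this
          simp only [Set.indicator_apply, Pi.one_apply, Finset.sum_boole]
          exact_mod_cast this
      _ = L := by simp
  have := ENNReal.toReal_mono (by simp) h
  rwa [ENNReal.toReal_sum fun i _ => measure_ne_top μ _, ENNReal.toReal_natCast] at this

open Classical in
/-- The main estimate. The clusterings `C j` are local modifications of one clustering `C₀`, at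
disjoint sets of pairs, and `U` contains all these pairs. Up to the first `L` queries in `U`, the
run under `C₀` separates at most `L` of the `C j` from `C₀`. If the queries in `U` are fewer than
a small multiple of the number of clusterings, two clusterings `C i`, `C j` are left such that, on
the common part of the laws under `C₀`, `C i` and `C j`, the runs under `C i` and `C j` mostly
agree with the run under `C₀` until they return the same answer. -/
theorem exists_le_errorProb {n : ℕ} {ν : Measure ℝ} {fg fr : ℝ → ℝ}
    (hg : IsProbDensity ν fg) (hr : IsProbDensity ν fr)
    {S : Type*} [MeasurableSpace S] (P : Measure S) [IsProbabilityMeasure P]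
    {A : S → SimMatrix n → QueryTree (Fin n)}
    (hA : Measurable fun p : S × SimMatrix n => A p.1 p.2)
    {ι : Type*} [Fintype ι] (hι : 2 ≤ Fintype.card ι)
    (U : Fin n → Fin n → Prop) (C₀ : Setoid (Fin n)) (C : ι → Setoid (Fin n))
    (hne : ∀ i, ∃ u v, ¬ (C i u v ↔ C₀ u v))
    (hC : ∀ u v i j, ¬ (C i u v ↔ C₀ u v) → ¬ (C j u v ↔ C₀ u v) → i = j)
    (hU : ∀ i u v, ¬ (C i u v ↔ C₀ u v) → U u v)
    (hH : hellingerSq ν fg fr ≤ 1) {B γ : ℝ} (hB : 0 < B) (hγ : 0 < γ)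
    (hs : ∑ i, ((Finset.univ.filter fun p : Pairs n =>
      ¬ (C i p.1.1 p.1.2 ↔ C₀ p.1.1 p.1.2)).card : ℝ) ≤ B * Fintype.card ι)
    (hN : ∀ N : ℕ, (N : ℝ) ≤ 12 * B → 9 * γ ≤ (1 - hellingerSq ν fg fr) ^ (4 * N))
    (hT : ∑ i, ∫⁻ z, ((A z.1 z.2).countQueries U (C i) : ℝ≥0∞) ∂(P.prod (simLaw ν fg fr (C i))) ≤
      ENNReal.ofReal (γ ^ 2 / 1152 * (Fintype.card ι : ℝ) ^ 2)) :
    ∃ i, ENNReal.ofReal (γ / 5) ≤ errorProb ν fg fr P A (C i) := by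
  by_contra! herr
  have hinj : Function.Injective C := fun i j hij => by
    obtain ⟨u, v, huv⟩ := hne i
    exact hC u v i j huv (hij ▸ huv)
  have hlaw := isProbabilityMeasure_simLaw (n := n) hg hr
  set μ : Setoid (Fin n) → Measure (S × SimMatrix n) := fun D => P.prod (simLaw ν fg fr D) with hμ
  have hμP : ∀ D, IsProbabilityMeasure (μ D) := fun D => by
    have := hlaw D
    simp only [hμ]
    infer_instance
  have hmeas : ∀ p : QueryTree (Fin n) → Prop,
      MeasurableSet {z : S × SimMatrix n | p (A z.1 z.2)} := fun p =>
    hA (MeasurableSpace.measurableSet_top (s := {t | p t}))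
  set m : ℝ := (Fintype.card ι : ℝ) with hm
  have hm2 : (2 : ℝ) ≤ m := by rw [hm]; exact_mod_cast hι
  set L : ℕ := ⌊γ / 48 * m⌋₊ with hL
  have hL1 : (L : ℝ) ≤ γ / 48 * m := Nat.floor_le (by positivity)
  have hL2 : γ / 48 * m < L + 1 := Nat.lt_floor_add_one _
  set E : ι → Set (S × SimMatrix n) := fun i =>
    {z | QueryTree.Separates U C₀ (C i) L (A z.1 z.2)} with hE
  set s : ι → ℕ := fun i => (Finset.univ.filter fun p : Pairs n =>
      ¬ (C i p.1.1 p.1.2 ↔ C₀ p.1.1 p.1.2)).card with hs'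
  set T : ι → ℝ≥0∞ := fun i =>
    ∫⁻ z, ((A z.1 z.2).countQueries U (C i) : ℝ≥0∞) ∂(μ (C i)) with hT'
  have hTtop : ∀ i ∈ Finset.univ, T i ≠ ⊤ := fun i hi =>
    ((Finset.single_le_sum (f := T) (fun _ _ => zero_le) hi).trans_lt
      (hT.trans_lt ENNReal.ofReal_lt_top)).ne
  have hTsum : ∑ i, (T i).toReal ≤ γ ^ 2 / 1152 * m ^ 2 := by
    rw [← ENNReal.toReal_sum hTtop]
    exact ENNReal.toReal_le_of_le_ofReal (by positivity) hT
  have hEsum : ∑ i, (μ C₀).real (E i) ≤ L :=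
    sum_measureReal_le (μ C₀) (fun i => hmeas fun t => QueryTree.Separates U C₀ (C i) L t)
      fun z => QueryTree.sum_separates_le hC L (A z.1 z.2)
  -- two clusterings for which all three quantities are at most six times their average bound
  obtain ⟨i, j, hij, hi, hj⟩ := exists_pair_le_of_sum_le hι (a := 3)
    (f := fun i => s i / B + (μ C₀).real (E i) / (γ / 48) +
      (T i).toReal / (γ ^ 2 / 1152 * m))
    (fun i => by positivity) (by
      rw [Finset.sum_add_distrib, Finset.sum_add_distrib, ← Finset.sum_div, ← Finset.sum_div,
        ← Finset.sum_div]
      have h1 : (∑ i, (s i : ℝ)) / B ≤ m := by rw [div_le_iff₀ hB]; linarith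
      have h2 : (∑ i, (μ C₀).real (E i)) / (γ / 48) ≤ m := by
        rw [div_le_iff₀ (by positivity)]; linarith
      have h3 : (∑ i, (T i).toReal) / (γ ^ 2 / 1152 * m) ≤ m := by
        rw [div_le_iff₀ (by positivity)]; linarith
      linarith)
  have hbounds : ∀ i, s i / B + (μ C₀).real (E i) / (γ / 48) +
      (T i).toReal / (γ ^ 2 / 1152 * m) ≤ 2 * 3 → (s i : ℝ) ≤ 6 * B ∧
        (μ C₀).real (E i) ≤ γ / 8 ∧ (T i).toReal ≤ 6 * (γ ^ 2 / 1152 * m) := by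
    intro i hi
    have h1 : 0 ≤ s i / B := by positivity
    have h2 : 0 ≤ (μ C₀).real (E i) / (γ / 48) := by positivity
    have h3 : 0 ≤ (T i).toReal / (γ ^ 2 / 1152 * m) := by positivity
    have h1' : s i / B ≤ 6 := by linarith
    have h2' : (μ C₀).real (E i) / (γ / 48) ≤ 6 := by linarith
    have h3' : (T i).toReal / (γ ^ 2 / 1152 * m) ≤ 6 := by linarith
    rw [div_le_iff₀ (by positivity)] at h1' h2' h3'
    exact ⟨h1', by linarith, h3'⟩
  obtain ⟨hsi, hEi, hTi⟩ := hbounds i hi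
  obtain ⟨hsj, hEj, -⟩ := hbounds j hj
  obtain ⟨Q, hQ0, hQi, hQj, hQ⟩ := exists_common_part hg hr P C₀ (C i) (C j) (N := s i + s j) (by
    refine le_trans (Finset.card_le_card ?_) (Finset.card_union_le _ _)
    intro p hp
    simp only [Finset.mem_union, Finset.mem_filter, Finset.mem_univ, true_and] at hp ⊢
    tauto)
  have hQfin : IsFiniteMeasure Q := isFiniteMeasure_of_le _ hQ0
  have hreal : ∀ D, Q ≤ μ D → ∀ X, Q.real X ≤ (μ D).real X := fun D h X =>
    ENNReal.toReal_mono (measure_ne_top _ _) (h X)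
  have hmass : γ ≤ Q.real Set.univ := by
    have h1 := hN (s i + s j) (by push_cast; linarith)
    have h2 := ENNReal.toReal_mono (ENNReal.mul_ne_top (by norm_num) (measure_ne_top Q _)) hQ
    rw [← ENNReal.ofReal_pow (by linarith), ENNReal.toReal_ofReal (pow_nonneg (by linarith) _),
      ENNReal.toReal_mul] at h2
    have h3 : (Q Set.univ).toReal = Q.real Set.univ := rfl
    rw [h3] at h2
    norm_num at h2
    linarith
  -- the events whose union is the whole space
  set F : ι → Set (S × SimMatrix n) := fun i => {z | (A z.1 z.2).result (C i) ≠ C i}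
  set X : Set (S × SimMatrix n) := {z | L < (A z.1 z.2).countQueries U (C i)} with hX
  have hcover : Set.univ ⊆ E i ∪ E j ∪ X ∪ F i ∪ F j := by
    intro z _
    by_contra hz
    simp only [Set.mem_union, not_or] at hz
    obtain ⟨⟨⟨⟨h1, h2⟩, h3⟩, h4⟩, h5⟩ := hz
    obtain ⟨ri, ci⟩ := QueryTree.result_eq_or_lt_countQueries (hU i) h1
    obtain ⟨rj, -⟩ := QueryTree.result_eq_or_lt_countQueries (hU j) h2
    have hc : (A z.1 z.2).countQueries U C₀ ≤ L := not_lt.1 fun h => h3 (ci h)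
    exact hij (hinj ((not_not.1 h4).symm.trans
      ((ri hc).trans ((rj hc).symm.trans (not_not.1 h5)))))
  have hXle : (μ (C i)).real X ≤ γ / 4 := by
    have hmark := mul_meas_ge_le_lintegral (μ := μ (C i))
      (f := fun z => ((A z.1 z.2).countQueries U (C i) : ℝ≥0∞))
      ((measurable_from_top (f := fun t : QueryTree (Fin n) =>
        (t.countQueries U (C i) : ℝ≥0∞))).comp hA) ((L + 1 : ℕ) : ℝ≥0∞)
    have hXeq : {z : S × SimMatrix n | ((L + 1 : ℕ) : ℝ≥0∞) ≤
        ((A z.1 z.2).countQueries U (C i) : ℝ≥0∞)} = X := by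
      ext z
      simp only [hX, Set.mem_ofPred_eq, Nat.cast_le, Nat.succ_le_iff]
    rw [hXeq] at hmark
    have := ENNReal.toReal_mono (hTtop i (Finset.mem_univ i)) hmark
    rw [ENNReal.toReal_mul, ENNReal.toReal_natCast] at this
    have h1 : ((L + 1 : ℕ) : ℝ) * (μ (C i)).real X ≤ 6 * (γ ^ 2 / 1152 * m) := this.trans hTi
    push_cast at h1
    have h0 : 0 ≤ (μ (C i)).real X := measureReal_nonneg
    have h2 : (γ / 48 * m) * (μ (C i)).real X ≤ (γ / 48 * m) * (γ / 4) := by nlinarith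
    exact le_of_mul_le_mul_left h2 (by positivity)
  have hF : ∀ i, (μ (C i)).real (F i) ≤ γ / 5 := fun i =>
    ENNReal.toReal_le_of_le_ofReal (by positivity) (herr i).le
  have htotal : Q.real Set.univ ≤ Q.real (E i) + Q.real (E j) + Q.real X + Q.real (F i) +
      Q.real (F j) := by
    refine (measureReal_mono hcover).trans ?_
    have a1 := measureReal_union_le (μ := Q) (E i ∪ E j ∪ X ∪ F i) (F j)
    have a2 := measureReal_union_le (μ := Q) (E i ∪ E j ∪ X) (F i)
    have a3 := measureReal_union_le (μ := Q) (E i ∪ E j) X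
    have a4 := measureReal_union_le (μ := Q) (E i) (E j)
    linarith
  have b1 := hreal _ hQ0 (E i)
  have b2 := hreal _ hQ0 (E j)
  have b3 := hreal _ hQi X
  have b4 := hreal _ hQi (F i)
  have b5 := hreal _ hQj (F j)
  have b6 := hF i
  have b7 := hF j
  linarith

/-! ### Clusterings given by labels -/

theorem numClusters_ker {n k : ℕ} {ℓ : Fin n → ℕ} (h : (Set.range ℓ).ncard = k) :
    numClusters (Setoid.ker ℓ) = k := by
  rw [numClusters, Nat.card_congr (Setoid.quotientKerEquivRange ℓ), ← h,
    Nat.card_coe_set_eq]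

/-- Moving an element `v` from a cluster of its own to the cluster with label `c` changes exactly
the relations between `v` and the elements of that cluster. -/
theorem ker_update_ne_iff {V : Type*} [DecidableEq V] {ℓ : V → ℕ} {v : V}
    (hv : ∀ u, u ≠ v → ℓ u ≠ ℓ v) (c : ℕ) (a b : V) :
    ¬ (Setoid.ker (Function.update ℓ v c) a b ↔ Setoid.ker ℓ a b) ↔
      (a = v ∧ b ≠ v ∧ ℓ b = c) ∨ (b = v ∧ a ≠ v ∧ ℓ a = c) := by
  simp only [Setoid.ker_def]
  by_cases ha : a = v <;> by_cases hb : b = v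
  · simp [ha, hb]
  · subst ha
    simp [hb, (hv b hb).symm, eq_comm]
  · subst hb
    simp [ha, hv a ha]
  · simp [ha, hb]

/-! ### Hiding a pair among singletons -/

theorem card_pairs (k : ℕ) : 2 * Fintype.card (Pairs k) + k = k * k := by
  classical
  have hlt : Fintype.card (Pairs k) =
      (Finset.univ.filter fun p : Fin k × Fin k => p.1 < p.2).card :=
    Fintype.card_subtype _
  have hgt : (Finset.univ.filter fun p : Fin k × Fin k => p.2 < p.1).card =
      (Finset.univ.filter fun p : Fin k × Fin k => p.1 < p.2).card :=
    Finset.card_equiv (Equiv.prodComm _ _) (by simp)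
  have heq : (Finset.univ.filter fun p : Fin k × Fin k => p.1 = p.2).card = k := by
    have : (Finset.univ.filter fun p : Fin k × Fin k => p.1 = p.2) =
        Finset.univ.image fun i => (i, i) := by
      ext ⟨a, b⟩; simp
    rw [this, Finset.card_image_of_injective _ fun a b h => (Prod.ext_iff.1 h).1]
    simp
  have hne := Finset.card_filter_add_card_filter_not (s := Finset.univ)
    (fun p : Fin k × Fin k => p.1 = p.2)
  have hsplit : (Finset.univ.filter fun p : Fin k × Fin k => ¬ p.1 = p.2) =
      (Finset.univ.filter fun p => p.1 < p.2) ∪ Finset.univ.filter fun p => p.2 < p.1 := by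
    ext p; simp [lt_or_lt_iff_ne]
  rw [hsplit, Finset.card_union_of_disjoint (Finset.disjoint_filter.2 fun p _ h => not_lt.2 h.le),
    heq, hgt, ← hlt] at hne
  simp at hne
  linarith

section FewElements

variable {n k : ℕ} {ν : Measure ℝ} {fg fr : ℝ → ℝ} {S : Type*} [MeasurableSpace S] (P : Measure S)
  [IsProbabilityMeasure P] {A : S → SimMatrix n → QueryTree (Fin n)}

/-- Few elements per cluster. In `C₀` the elements `0, …, k - 1` are singletons and all others form
one more cluster; the clusterings with `k` clusters compared with it merge two of the singletons.
There are about `k² / 2` of them. -/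
theorem exists_le_errorProb_of_le_two_mul (hg : IsProbDensity ν fg) (hr : IsProbDensity ν fr)
    (hA : Measurable fun p : S × SimMatrix n => A p.1 p.2) (hk : 3 ≤ k) (hkn : k < n)
    (hn : n ≤ 2 * k) (hH : hellingerSq ν fg fr ≤ 1) {γ : ℝ} (hγ : 0 < γ)
    (hN : ∀ N : ℕ, (N : ℝ) ≤ 12 * 1 → 9 * γ ≤ (1 - hellingerSq ν fg fr) ^ (4 * N))
    (hT : ∀ C : Setoid (Fin n), numClusters C = k →
      expectedQueries ν fg fr P A C ≤ ENNReal.ofReal (γ ^ 2 / 7000 * (n * k))) :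
    ∃ C : Setoid (Fin n), numClusters C = k ∧ ENNReal.ofReal (γ / 5) ≤ errorProb ν fg fr P A C := by
  classical
  set ℓ : Fin n → ℕ := fun i => min i k with hℓ
  have hlt : ∀ {a : Fin n} {j : Fin k}, ℓ a = j → (a : ℕ) = j := fun {a j} h => by
    have := j.2
    simp only [hℓ] at h
    omega
  set v : Pairs k → Fin n := fun p => Fin.castLE hkn.le p.1.2 with hv
  set C : Pairs k → Setoid (Fin n) := fun p =>
    Setoid.ker (Function.update ℓ (v p) (p.1.1 : ℕ)) with hC
  have huniq : ∀ p u, u ≠ v p → ℓ u ≠ ℓ (v p) := fun p u hu h => hu <| Fin.ext <| by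
    have h1 : ℓ (v p) = (p.1.2 : ℕ) := min_eq_left p.1.2.2.le
    rw [h1] at h
    rw [hlt h]
    rfl
  have hdiff := fun p a b => ker_update_ne_iff (huniq p) (p.1.1 : ℕ) a b
  have hends : ∀ p a b, ¬ (C p a b ↔ Setoid.ker ℓ a b) →
      ((a : ℕ) = p.1.1 ∧ (b : ℕ) = p.1.2) ∨ ((a : ℕ) = p.1.2 ∧ (b : ℕ) = p.1.1) := by
    intro p a b h
    rcases (hdiff p a b).1 h with ⟨rfl, -, h⟩ | ⟨rfl, -, h⟩
    · exact .inr ⟨rfl, hlt h⟩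
    · exact .inl ⟨hlt h, rfl⟩
  have hclusters : ∀ p, numClusters (C p) = k := by
    intro p
    refine numClusters_ker ?_
    have hrange : Set.range (Function.update ℓ (v p) (p.1.1 : ℕ)) =
        ((Finset.range (k + 1)).erase (p.1.2 : ℕ) : Finset ℕ) := by
      have h12 : (p.1.1 : ℕ) < p.1.2 := p.2
      have h2 := p.1.2.2
      ext y
      simp only [Set.mem_range, Finset.coe_erase, Finset.coe_range, Set.mem_sdiff, Set.mem_Iio,
        Set.mem_singleton_iff]
      constructor
      · rintro ⟨u, rfl⟩
        by_cases hu : u = v p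
        · subst hu
          rw [Function.update_self]
          omega
        · rw [Function.update_of_ne hu]
          refine ⟨by simp only [hℓ]; omega, fun h => hu (Fin.ext ?_)⟩
          rw [hlt h]
          rfl
      · rintro ⟨hy, hy'⟩
        refine ⟨⟨y, by omega⟩, ?_⟩
        rw [Function.update_of_ne fun h => hy' (by rw [Fin.ext_iff] at h; exact h)]
        simp only [hℓ]
        omega
    rw [hrange, Set.ncard_coe_finset, Finset.card_erase_of_mem, Finset.card_range]
    · omega
    · have := p.1.2.2
      simp only [Finset.mem_range]
      omega
  have hcard := card_pairs k
  have hcard2 : 2 ≤ Fintype.card (Pairs k) := by nlinarith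
  have hcard3 : (k : ℝ) * k ≤ 3 * Fintype.card (Pairs k) := by
    exact_mod_cast (show k * k ≤ 3 * Fintype.card (Pairs k) by nlinarith)
  obtain ⟨p, hp⟩ := exists_le_errorProb hg hr P hA hcard2 (fun _ _ => True) (Setoid.ker ℓ) C
    (fun p => ⟨v p, Fin.castLE hkn.le p.1.1, (hdiff p _ _).2 (.inl ⟨rfl, fun h => by
      have : p.1.1 = p.1.2 := Fin.castLE_injective _ h
      exact p.2.ne this, min_eq_left p.1.1.2.le⟩)⟩)
    (fun a b p p' h h' => by
      have h1 : (p.1.1 : ℕ) < p.1.2 := p.2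
      have h2 : (p'.1.1 : ℕ) < p'.1.2 := p'.2
      have := hends p a b h
      have := hends p' a b h'
      exact Subtype.ext (Prod.ext (Fin.ext (by omega)) (Fin.ext (by omega))))
    (fun _ _ _ _ => trivial) hH one_pos hγ
    (by
      rw [one_mul]
      calc _ ≤ ∑ p : Pairs k, (1 : ℝ) := by
            refine Finset.sum_le_sum fun p _ => ?_
            norm_cast
            refine Finset.card_le_one.2 fun a ha b hb => ?_
            have h0 : (p.1.1 : ℕ) < p.1.2 := p.2
            have h1 : (a.1.1 : ℕ) < a.1.2 := a.2
            have h2 : (b.1.1 : ℕ) < b.1.2 := b.2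
            have := hends p _ _ (Finset.mem_filter.1 ha).2
            have := hends p _ _ (Finset.mem_filter.1 hb).2
            exact Subtype.ext (Prod.ext (Fin.ext (by omega)) (Fin.ext (by omega)))
        _ = _ := by simp)
    hN
    (by
      simp_rw [QueryTree.countQueries_true]
      refine (Finset.sum_le_sum fun p _ => hT (C p) (hclusters p)).trans ?_
      rw [Finset.sum_const, Finset.card_univ, nsmul_eq_mul, ← ENNReal.ofReal_natCast,
        ← ENNReal.ofReal_mul (by positivity)]
      refine ENNReal.ofReal_le_ofReal ?_
      have hn' : (n : ℝ) ≤ 2 * k := by exact_mod_cast hn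
      have h1 : (n : ℝ) * k ≤ 6 * Fintype.card (Pairs k) := by nlinarith
      have h2 : γ ^ 2 / 7000 * (n * k) ≤ γ ^ 2 / 7000 * (6 * Fintype.card (Pairs k)) := by gcongr
      have h3 : (0 : ℝ) ≤ γ ^ 2 * Fintype.card (Pairs k) := by positivity
      nlinarith)
  exact ⟨C p, hclusters p, hp⟩

end FewElements

/-! ### Hiding the cluster of one element -/

/-- Resampling one coordinate of a uniformly random function does not change its law. -/
theorem sum_sum_update {ι κ : Type*} [Fintype ι] [DecidableEq ι] [Fintype κ] (v : ι)
    (f : (ι → κ) → ℝ≥0∞) :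
    ∑ x, ∑ j, f (Function.update x v j) = Fintype.card κ * ∑ x, f x := by
  classical
  have hinv : Function.Involutive fun p : (ι → κ) × κ => (Function.update p.1 v p.2, p.1 v) :=
    fun p => by simp
  have h := Fintype.sum_equiv hinv.toPerm (fun p => f (Function.update p.1 v p.2))
    (fun p => f p.1) fun p => rfl
  rw [Fintype.sum_prod_type, Fintype.sum_prod_type] at h
  rw [h, Finset.mul_sum]
  exact Finset.sum_congr rfl fun x _ => by simp

section ManyElements

variable {n q m : ℕ}

/-- Labels of a clustering with `q + 1` clusters: the element `i < m` has the label `x i`, which is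
less than `q`; the next elements have the labels `0, 1, …, q - 1`, and all others the label `q`. -/
def freeLabel (n : ℕ) (x : Fin m → Fin q) (i : Fin n) : ℕ :=
  if h : (i : ℕ) < m then x ⟨i, h⟩ else min (i - m) q

theorem numClusters_freeLabel (hmk : m + (q + 1) ≤ n) (x : Fin m → Fin q) :
    numClusters (Setoid.ker (freeLabel n x)) = q + 1 := by
  refine numClusters_ker ?_
  have : Set.range (freeLabel n x) = (Finset.range (q + 1) : Finset ℕ) := by
    ext y
    simp only [Set.mem_range, Finset.coe_range, Set.mem_Iio]
    constructor
    · rintro ⟨i, rfl⟩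
      unfold freeLabel
      split_ifs with h
      · have := (x ⟨i, h⟩).2
        omega
      · omega
    · intro hy
      refine ⟨⟨m + y, by omega⟩, ?_⟩
      unfold freeLabel
      rw [dif_neg (by simp)]
      simp only
      omega
  rw [this, Set.ncard_coe_finset, Finset.card_range]

theorem freeLabel_update (hmn : m ≤ n) (x : Fin m → Fin q) (v : Fin m) (j : Fin q) :
    freeLabel n (Function.update x v j) =
      Function.update (freeLabel n x) (Fin.castLE hmn v) (j : ℕ) := by
  ext i
  by_cases hi : i = Fin.castLE hmn v
  · subst hi
    simp [freeLabel]
  · rw [Function.update_of_ne hi]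
    unfold freeLabel
    split_ifs with h
    · rw [Function.update_of_ne]
      rintro rfl
      exact hi rfl
    · rfl

theorem freeLabel_lt (x : Fin m → Fin q) (i : Fin n) :
    freeLabel n x i < q + 1 := by
  unfold freeLabel
  split_ifs with h
  · have := (x ⟨i, h⟩).2
    omega
  · omega

theorem lt_of_freeLabel_lt (x : Fin m → Fin q) {i : Fin n} (h : freeLabel n x i < q) :
    (i : ℕ) < m + q := by
  unfold freeLabel at h
  split_ifs at h <;> omega

variable {ν : Measure ℝ} {fg fr : ℝ → ℝ} {S : Type*} [MeasurableSpace S] (P : Measure S)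
  [IsProbabilityMeasure P] {A : S → SimMatrix n → QueryTree (Fin n)}

/-- Many elements per cluster. The first `m` elements are placed in `q` clusters uniformly at
random, so that some element `v` and some placement of the others can be fixed for which, averaged
over the `q` clusters to which `v` may belong, few queries involve `v`. In `C₀` this `v` is a
cluster of its own. The sizes of the `q` clusters need no further control, because their average is
at most `(m + q) / q`. -/
theorem exists_le_errorProb_of_free (hg : IsProbDensity ν fg) (hr : IsProbDensity ν fr)
    (hA : Measurable fun p : S × SimMatrix n => A p.1 p.2) (hq : 2 ≤ q) (hm : 1 ≤ m)
    (hmk : m + (q + 1) ≤ n) (hH : hellingerSq ν fg fr ≤ 1) {γ : ℝ} (hγ : 0 < γ)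
    (hN : ∀ N : ℕ, (N : ℝ) ≤ 12 * (((m + q : ℕ) : ℝ) / (q : ℝ)) →
      9 * γ ≤ (1 - hellingerSq ν fg fr) ^ (4 * N))
    (hT : ∀ C : Setoid (Fin n), numClusters C = q + 1 →
      expectedQueries ν fg fr P A C ≤ ENNReal.ofReal (γ ^ 2 / 2304 * (m * q))) :
    ∃ C : Setoid (Fin n), numClusters C = q + 1 ∧ ENNReal.ofReal (γ / 5) ≤ errorProb ν fg fr P A C := by
  classical
  have hmn : m ≤ n := by omega
  set e : Fin m → Fin n := Fin.castLE hmn with he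
  have heinj : Function.Injective e := Fin.castLE_injective hmn
  set D : (Fin m → Fin q) → Setoid (Fin n) := fun x => Setoid.ker (freeLabel n x) with hD
  have hDk : ∀ x, numClusters (D x) = q + 1 := numClusters_freeLabel hmk
  set T : (Fin m → Fin q) → Fin m → ℝ≥0∞ := fun x v =>
    ∫⁻ z, ((A z.1 z.2).countQueries (fun a b => a = e v ∨ b = e v) (D x) : ℝ≥0∞)
      ∂(P.prod (simLaw ν fg fr (D x))) with hTdef
  set Y : ℝ := γ ^ 2 / 2304 * (m * q) with hY
  have hTsum : ∀ x, ∑ v, T x v ≤ 2 * ENNReal.ofReal Y := by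
    intro x
    have hmeas : ∀ f : QueryTree (Fin n) → ℝ≥0∞,
        Measurable fun z : S × SimMatrix n => f (A z.1 z.2) := fun f =>
      (measurable_from_top (f := f)).comp hA
    calc ∑ v, T x v = ∫⁻ z, ∑ v, ((A z.1 z.2).countQueries (fun a b => a = e v ∨ b = e v) (D x)
          : ℝ≥0∞) ∂(P.prod (simLaw ν fg fr (D x))) :=
          (lintegral_finsetSum _ fun v _ => hmeas fun t =>
            (t.countQueries (fun a b => a = e v ∨ b = e v) (D x) : ℝ≥0∞)).symm
      _ ≤ ∫⁻ z, 2 * ((A z.1 z.2).numQueries (D x) : ℝ≥0∞) ∂(P.prod (simLaw ν fg fr (D x))) :=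
          lintegral_mono fun z => by
            dsimp only
            exact_mod_cast QueryTree.sum_countQueries_le heinj (D x) (A z.1 z.2)
      _ = 2 * expectedQueries ν fg fr P A (D x) :=
          lintegral_const_mul _ (hmeas fun t => (t.numQueries (D x) : ℝ≥0∞))
      _ ≤ _ := by
          gcongr
          exact hT _ (hDk x)
  have hpos : 0 < q := by omega
  obtain ⟨⟨x, v⟩, -, hxv⟩ := ENNReal.exists_le_of_sum_le
    (s := (Finset.univ : Finset ((Fin m → Fin q) × Fin m)))
    (f := fun p => ∑ j, T (Function.update p.1 p.2 j) p.2)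
    (g := fun _ => ENNReal.ofReal (γ ^ 2 / 1152 * (q : ℝ) ^ 2))
    ⟨(fun _ => ⟨0, hpos⟩, ⟨0, by omega⟩), Finset.mem_univ _⟩ (by
      rw [Fintype.sum_prod_type_right]
      simp_rw [fun v => sum_sum_update v fun x => T x v]
      rw [← Finset.mul_sum, Finset.sum_comm]
      refine (mul_le_mul_right (Finset.sum_le_sum fun x _ => hTsum x) _).trans (le_of_eq ?_)
      rw [Finset.sum_const, Finset.sum_const, nsmul_eq_mul, nsmul_eq_mul, Finset.card_univ,
        Finset.card_univ, Fintype.card_prod, Fintype.card_fin, Fintype.card_fin, Nat.cast_mul,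
        ← ENNReal.ofReal_natCast q, ← ENNReal.ofReal_natCast m,
        ← ENNReal.ofReal_natCast (Fintype.card _), show (2 : ℝ≥0∞) = ENNReal.ofReal 2 by simp]
      iterate 5 rw [← ENNReal.ofReal_mul (by positivity)]
      congr 1
      rw [hY]
      ring)
  -- the label `q + 1` occurs nowhere else, so `v` becomes a singleton
  set ℓ : Fin n → ℕ := Function.update (freeLabel n x) (e v) (q + 1) with hℓ
  have hDj : ∀ j, D (Function.update x v j) = Setoid.ker (Function.update ℓ (e v) (j : ℕ)) := by
    intro j
    rw [hℓ, Function.update_idem, hD]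
    dsimp only
    rw [freeLabel_update hmn]
  have hℓne : ∀ u, u ≠ e v → ℓ u = freeLabel n x u := fun u hu => Function.update_of_ne hu _ _
  have huniq : ∀ u, u ≠ e v → ℓ u ≠ ℓ (e v) := fun u hu => by
    rw [hℓne u hu, hℓ, Function.update_self]
    exact (freeLabel_lt x u).ne
  have hdiff : ∀ (j : Fin q) a b,
      ¬ (D (Function.update x v j) a b ↔ Setoid.ker ℓ a b) ↔
      (a = e v ∧ b ≠ e v ∧ ℓ b = j) ∨ (b = e v ∧ a ≠ e v ∧ ℓ a = j) := fun j a b => by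
    rw [hDj j]
    exact ker_update_ne_iff huniq (j : ℕ) a b
  have hev : (e v : ℕ) = v := rfl
  obtain ⟨j, hj⟩ := exists_le_errorProb hg hr P hA (ι := Fin q) (by simpa using hq)
    (fun a b => a = e v ∨ b = e v) (Setoid.ker ℓ) (fun j => D (Function.update x v j))
    (fun j => by
      have hne : (⟨m + j, by have := j.2; omega⟩ : Fin n) ≠ e v := fun h => by
        rw [Fin.ext_iff, hev] at h
        have := v.2
        simp only at h
        omega
      refine ⟨e v, ⟨m + j, by have := j.2; omega⟩, (hdiff j _ _).2 (.inl ⟨rfl, hne, ?_⟩)⟩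
      rw [hℓne _ hne, freeLabel, dif_neg (by simp)]
      have := j.2
      simp only
      omega)
    (fun a b i j hi hj => by
      rcases (hdiff i a b).1 hi with ⟨h1, h2, h3⟩ | ⟨h1, h2, h3⟩ <;>
        rcases (hdiff j a b).1 hj with ⟨h4, h5, h6⟩ | ⟨h4, h5, h6⟩
      · exact Fin.ext (h3.symm.trans h6)
      · exact absurd h1 h5
      · exact absurd h4 h2
      · exact Fin.ext (h3.symm.trans h6))
    (fun j a b h => by
      rcases (hdiff j a b).1 h with h | h
      exacts [.inl h.1, .inr h.1])
    hH (B := ((m + q : ℕ) : ℝ) / (q : ℝ)) (by positivity) hγ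
    (by
      rw [Fintype.card_fin, div_mul_cancel₀ _ (by positivity)]
      norm_cast
      -- a relevant pair is determined by its endpoint other than `v`
      calc _ ≤ ∑ j : Fin q, ((Finset.univ.filter fun w : Fin n => (w : ℕ) < m + q).filter
              fun w => ℓ w = j).card := by
            refine Finset.sum_le_sum fun j _ => Finset.card_le_card_of_injOn
              (fun p => if p.1.1 = e v then p.1.2 else p.1.1) ?_ ?_
            · intro p hp
              have hp' := (hdiff j _ _).1 (Finset.mem_filter.1 hp).2
              have hj := j.2
              simp only [Finset.coe_filter, Finset.mem_filter, Finset.mem_univ, true_and,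
                Set.mem_ofPred_eq]
              rcases hp' with ⟨h1, h2, h3⟩ | ⟨h1, h2, h3⟩
              · rw [if_pos h1]
                refine ⟨lt_of_freeLabel_lt x ?_, h3⟩
                rw [← hℓne _ h2, h3]
                exact hj
              · rw [if_neg h2]
                refine ⟨lt_of_freeLabel_lt x ?_, h3⟩
                rw [← hℓne _ h2, h3]
                exact hj
            · intro p hp p' hp' hpp
              have h := (hdiff j _ _).1 (Finset.mem_filter.1 hp).2
              have h' := (hdiff j _ _).1 (Finset.mem_filter.1 hp').2
              have hlt : p.1.1 < p.1.2 := p.2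
              have hlt' : p'.1.1 < p'.1.2 := p'.2
              dsimp only at hpp
              rcases h with ⟨h1, h2, -⟩ | ⟨h1, h2, -⟩ <;>
                rcases h' with ⟨h1', h2', -⟩ | ⟨h1', h2', -⟩
              · rw [if_pos h1, if_pos h1'] at hpp
                exact Subtype.ext (Prod.ext (h1.trans h1'.symm) hpp)
              · rw [if_pos h1, if_neg h2'] at hpp
                rw [h1, hpp] at hlt
                rw [h1'] at hlt'
                exact absurd hlt' hlt.asymm
              · rw [if_neg h2, if_pos h1'] at hpp
                rw [h1, hpp] at hlt
                rw [h1'] at hlt'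
                exact absurd hlt' hlt.asymm
              · rw [if_neg h2, if_neg h2'] at hpp
                exact Subtype.ext (Prod.ext hpp (h1.trans h1'.symm))
        _ ≤ (Finset.univ.filter fun w : Fin n => (w : ℕ) < m + q).card := by
            rw [← Finset.card_biUnion]
            · exact Finset.card_le_card (Finset.biUnion_subset.2 fun j _ =>
                Finset.filter_subset _ _)
            · intro i _ j _ hij
              exact Finset.disjoint_filter.2 fun w _ h h' => hij (Fin.ext (h.symm.trans h'))
        _ ≤ (Finset.range (m + q)).card := Finset.card_le_card_of_injOn (fun w => (w : ℕ))
              (fun w hw => by simpa using hw) fun a _ b _ h => Fin.ext h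
        _ = _ := Finset.card_range _)
    hN (by rw [Fintype.card_fin]; exact hxv)
  exact ⟨_, hDk _, hj⟩

end ManyElements

/-! ### The query lower bound -/

theorem exp_neg_div_le_one_sub {h η : ℝ} (h0 : 0 ≤ h) (hη : h ≤ η) (hη1 : η < 1) :
    Real.exp (-(h / (1 - η))) ≤ 1 - h := by
  have h1 : 0 < 1 - h := by linarith
  have h2 : 0 < 1 - η := by linarith
  rw [Real.exp_neg]
  refine inv_le_of_inv_le₀ h1 ?_
  have h3 : h / (1 - h) ≤ h / (1 - η) := by gcongr
  calc (1 - h)⁻¹ = h / (1 - h) + 1 := by field_simp; ring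
    _ ≤ h / (1 - η) + 1 := by linarith
    _ ≤ _ := Real.add_one_le_exp _

theorem exp_neg_le_one_sub_pow {h η : ℝ} (h0 : 0 ≤ h) (hη : h ≤ η) (hη1 : η < 1) {N : ℕ}
    (hN : N * h ≤ 30) : Real.exp (-(120 / (1 - η))) ≤ (1 - h) ^ (4 * N) := by
  have h2 : 0 < 1 - η := by linarith
  calc Real.exp (-(120 / (1 - η))) ≤ Real.exp ((4 * N : ℕ) * -(h / (1 - η))) := by
        refine Real.exp_le_exp.2 ?_
        push_cast
        rw [mul_neg, neg_le_neg_iff, ← mul_div_assoc]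
        gcongr
        linarith
    _ = Real.exp (-(h / (1 - η))) ^ (4 * N) := Real.exp_nat_mul _ _
    _ ≤ _ := pow_le_pow_left₀ (Real.exp_nonneg _) (exp_neg_div_le_one_sub h0 hη hη1) _

theorem theorem1 (η : ℝ) (hη : η < 1) :
    ∃ c δ : ℝ, 0 < c ∧ 0 < δ ∧
      ∀ (n k : ℕ), 3 ≤ k → k < n →
      ∀ (ν : Measure ℝ) (fg fr : ℝ → ℝ), IsProbDensity ν fg → IsProbDensity ν fr →
        hellingerSq ν fg fr ≤ η →
      ∀ (S : Type*) [MeasurableSpace S] (P : Measure S) [IsProbabilityMeasure P]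
        (A : S → SimMatrix n → QueryTree (Fin n)),
        Measurable (fun p : S × SimMatrix n => A p.1 p.2) →
        (∀ C : Setoid (Fin n), numClusters C = k →
          expectedQueries ν fg fr P A C <
            ENNReal.ofReal c *
              min ((k : ℝ≥0∞) ^ 2 / ENNReal.ofReal (hellingerSq ν fg fr))
                ((n : ℝ≥0∞) * (k : ℝ≥0∞))) →
        ∃ C : Setoid (Fin n), numClusters C = k ∧
          ENNReal.ofReal δ ≤ errorProb ν fg fr P A C := by
  set γ : ℝ := Real.exp (-(120 / (1 - η))) / 9 with hγdef
  have hγ : 0 < γ := by positivity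
  refine ⟨γ ^ 2 / 7000, γ / 5, by positivity, by positivity, ?_⟩
  intro n k hk hkn ν fg fr hg hr hh S _ P _ A hA hT
  set h := hellingerSq ν fg fr with hhdef
  have h0 : 0 ≤ h := hellingerSq_nonneg ν fg fr
  have h1 : h ≤ 1 := hh.trans hη.le
  have hmass : ∀ N : ℕ, N * h ≤ 30 → 9 * γ ≤ (1 - h) ^ (4 * N) := fun N hN => by
    rw [hγdef, mul_div_cancel₀ _ (by norm_num)]
    exact exp_neg_le_one_sub_pow h0 hh hη hN
  have hTnk : ∀ C : Setoid (Fin n), numClusters C = k →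
      expectedQueries ν fg fr P A C ≤ ENNReal.ofReal (γ ^ 2 / 7000 * (n * k)) := fun C hC => by
    refine (hT C hC).le.trans ?_
    rw [ENNReal.ofReal_mul (by positivity), ENNReal.ofReal_mul (by positivity),
      ENNReal.ofReal_natCast, ENNReal.ofReal_natCast]
    gcongr
    exact min_le_right _ _
  rcases le_or_gt n (2 * k) with hn | hn
  · exact exists_le_errorProb_of_le_two_mul P hg hr hA hk hkn hn h1 hγ
      (fun N hN => hmass N (by nlinarith)) hTnk
  obtain ⟨q, rfl⟩ : ∃ q, k = q + 1 := ⟨k - 1, by omega⟩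
  -- the last cluster only absorbs the surplus elements, and two others remain because `k ≥ 3`
  have hq : 2 ≤ q := by omega
  have hq' : (2 : ℝ) ≤ q := by exact_mod_cast hq
  push_cast at hTnk
  -- Take as many free elements as the Hellinger divergence allows: a cluster then has about
  -- `1 / h` of them, and moving one element changes the law of the matrix only moderately.
  obtain ⟨m, hm, hmn, hmh, hTm⟩ : ∃ m : ℕ, 1 ≤ m ∧ m + (q + 1) ≤ n ∧ m * h ≤ q + 1 ∧
      ∀ C : Setoid (Fin n), numClusters C = q + 1 →
        expectedQueries ν fg fr P A C ≤ ENNReal.ofReal (γ ^ 2 / 2304 * (m * q)) := by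
    have hγ2 : 0 < γ ^ 2 := by positivity
    rcases le_or_gt (((n - (q + 1) : ℕ) : ℝ) * h) (q + 1) with hc | hc
    · refine ⟨n - (q + 1), by omega, by omega, hc, fun C hC => (hTnk C hC).trans
        (ENNReal.ofReal_le_ofReal ?_)⟩
      have hnm : (n : ℝ) ≤ 2 * (n - (q + 1) : ℕ) := by
        exact_mod_cast (show n ≤ 2 * (n - (q + 1)) by omega)
      calc γ ^ 2 / 7000 * (n * (q + 1))
          ≤ γ ^ 2 / 7000 * ((2 * (n - (q + 1) : ℕ)) * (3 / 2 * q)) := by gcongr; linarith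
        _ = γ ^ 2 * (3 / 7000) * ((n - (q + 1) : ℕ) * q) := by ring
        _ ≤ γ ^ 2 * (1 / 2304) * ((n - (q + 1) : ℕ) * q) := by gcongr γ ^ 2 * ?_ * _; norm_num
        _ = _ := by ring
    · have hpos : 0 < h := h0.lt_of_ne fun h' => by rw [← h', mul_zero] at hc; linarith
      have hge : 1 ≤ ((q : ℝ) + 1) / h := by rw [le_div_iff₀ hpos]; linarith
      have hfl := Nat.floor_le (zero_le_one.trans hge)
      have hfl' := Nat.lt_floor_add_one (((q : ℝ) + 1) / h)
      have hm1 : 1 ≤ ⌊((q : ℝ) + 1) / h⌋₊ := Nat.floor_pos.2 hge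
      have hm1' : (1 : ℝ) ≤ ⌊((q : ℝ) + 1) / h⌋₊ := by exact_mod_cast hm1
      refine ⟨⌊((q : ℝ) + 1) / h⌋₊, hm1, ?_, ?_, fun C hC => (hT C hC).le.trans ?_⟩
      · have : ⌊((q : ℝ) + 1) / h⌋₊ ≤ n - (q + 1) := by
          refine Nat.floor_le_of_le ?_
          rw [div_le_iff₀ hpos]
          exact hc.le
        omega
      · exact (le_div_iff₀ hpos).1 hfl
      · have hX : ((q + 1 : ℕ) : ℝ≥0∞) ^ 2 / ENNReal.ofReal h =
            ENNReal.ofReal (((q : ℝ) + 1) ^ 2 / h) := by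
          rw [ENNReal.ofReal_div_of_pos hpos, ENNReal.ofReal_pow (by positivity),
            ← Nat.cast_add_one, ENNReal.ofReal_natCast]
        refine (mul_le_mul_right (min_le_left _ _) _).trans ?_
        rw [hX, ← ENNReal.ofReal_mul (by positivity)]
        refine ENNReal.ofReal_le_ofReal ?_
        set m := ⌊((q : ℝ) + 1) / h⌋₊
        calc γ ^ 2 / 7000 * (((q : ℝ) + 1) ^ 2 / h)
            = γ ^ 2 / 7000 * ((((q : ℝ) + 1) / h) * (q + 1)) := by ring
          _ ≤ γ ^ 2 / 7000 * ((2 * m) * (3 / 2 * q)) := by gcongr <;> linarith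
          _ = γ ^ 2 * (3 / 7000) * (m * q) := by ring
          _ ≤ γ ^ 2 * (1 / 2304) * (m * q) := by gcongr γ ^ 2 * ?_ * _; norm_num
          _ = _ := by ring
  refine exists_le_errorProb_of_free P hg hr hA hq hm hmn h1 hγ (fun N hN => hmass N ?_) hTm
  rw [← mul_div_assoc, le_div_iff₀ (by positivity)] at hN
  push_cast at hN
  have h2 : N * q * h ≤ 12 * (m + q) * h := by gcongr
  have h3 : (N * h) * q ≤ 30 * q := by nlinarith
  exact le_of_mul_le_mul_right h3 (by positivity)
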